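/- A barred pattern of length $k$ is a permutation $\sigma\in S_k$, in one-line notation, some of whose letters carry a bar. Let $\sigma'$ be the word formed by the unbarred letters of $\sigma$ and let $\sigma''\in S_k$ be the underlying permutation (bars ignored). A copy of a word $w$ of distinct letters in a permutation $\pi=\pi_1\cdots\pi_n\in S_n$ is a subsequence $\pi_{i_1}\cdots\pi_{i_m}$, $i_1<\cdots<i_m$, that is order-isomorphic to $w$. The permutation $\pi$ avoids the barred pattern $\sigma$ if every copy of $\sigma'$ in $\pi$ extends to a copy of $\sigma''$ in $\pi$, the added letters playing the roles of the barred letters (this holds vacuously if $\pi$ has no copy of $\sigma'$). Let $S_n(\sigma)$ be the set of $\pi\in S_n$ that avoid $\sigma$, and write $\sigma\equiv\tau$ (Wilf-equivalence) if $|S_n(\sigma)|=|S_n(\tau)|$ for all $n\ge 0$. Corollary. $3\bar{5}124\equiv 1\bar{5}324$ and $1\bar{3}524\equiv 5\bar{3}124$. -/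

import Mathlib

/-- A barred pattern of length `k`: a permutation in one-line notation, some of whose letters carry
a bar.  Positions and letters are numbered from `0` (only the relative order of letters matters). -/
structure BarredPattern (k : ℕ) where
  /-- the underlying permutation; `perm i` is the letter at position `i` -/
  perm : Equiv.Perm (Fin k)
  /-- the set of positions whose letter is barred -/
  barred : Finset (Fin k)

/-- The positions `f i` (`i : ι`), increasing in `i`, of the permutation `π` carry a subsequence
that is order-isomorphic to the word `w`, i.e. they form a copy of `w` in `π`. -/
def IsCopy {ι α : Type*} [LinearOrder ι] [LinearOrder α] {n : ℕ}
    (w : ι → α) (π : Equiv.Perm (Fin n)) (f : ι → Fin n) : Prop :=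
  StrictMono f ∧ ∀ i j, π (f i) < π (f j) ↔ w i < w j

namespace BarredPattern

/-- The word of the unbarred letters, indexed by the unbarred positions in increasing order. -/
def unbarredWord {k : ℕ} (σ : BarredPattern k) : {i : Fin k // i ∉ σ.barred} → Fin k :=
  fun i => σ.perm i

/-- `π` avoids `σ` if every copy in `π` of the pattern formed by the unbarred letters extends to a
copy of the whole underlying permutation (the new letters playing the roles of the barred ones). -/
def Avoids {n k : ℕ} (π : Equiv.Perm (Fin n)) (σ : BarredPattern k) : Prop :=
  ∀ f : {i : Fin k // i ∉ σ.barred} → Fin n, IsCopy σ.unbarredWord π f →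
    ∃ g : Fin k → Fin n, IsCopy σ.perm π g ∧ ∀ i : {i : Fin k // i ∉ σ.barred}, g i = f i

/-- The set of permutations of length `n` that avoid `σ`. -/
def avoiders {k : ℕ} (σ : BarredPattern k) (n : ℕ) : Set (Equiv.Perm (Fin n)) :=
  {π | Avoids π σ}

/-- Two barred patterns are Wilf-equivalent if for every `n ≥ 0` they are avoided by equally many
permutations of length `n`. -/
def WilfEquivalent {k l : ℕ} (σ : BarredPattern k) (τ : BarredPattern l) : Prop :=
  ∀ n : ℕ, (σ.avoiders n).ncard = (τ.avoiders n).ncard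

/-- The barred pattern 3 5̄ 1 2 4. -/
def p3b5124 : BarredPattern 5 where
  perm := ⟨![2, 4, 0, 1, 3], ![2, 3, 0, 4, 1], by decide, by decide⟩
  barred := {1}

/-- The barred pattern 1 5̄ 3 2 4. -/
def p1b5324 : BarredPattern 5 where
  perm := ⟨![0, 4, 2, 1, 3], ![0, 3, 2, 4, 1], by decide, by decide⟩
  barred := {1}

/-- The barred pattern 1 3̄ 5 2 4. -/
def p1b3524 : BarredPattern 5 where
  perm := ⟨![0, 2, 4, 1, 3], ![0, 3, 1, 4, 2], by decide, by decide⟩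
  barred := {1}

/-- The barred pattern 5 3̄ 1 2 4. -/
def p5b3124 : BarredPattern 5 where
  perm := ⟨![4, 2, 0, 1, 3], ![2, 3, 1, 4, 0], by decide, by decide⟩
  barred := {1}

end BarredPattern

/-! Each of the four patterns is avoided exactly when no adjacent pair of letters, with two later
letters c < d, forms a copy of the unbarred word: such a copy leaves no room for the barred letter,
and a non-extendable copy can be tightened to one (`avoids_iff_forall_not`, `exists_step`). The two
patterns of an equivalence give the same relation R on x < y (the pair) and c < d, once with the
pair descending and once ascending.

By inclusion-exclusion it suffices to match, for each set S of positions, the permutations with bad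
ascents throughout S and those with bad descents throughout S. Reversing every block of positions
joined by S does this. Since c lies between x and y, it is outside the block of the pair. In
decreasing blocks c and d never share a block; in increasing ones the witnesses can be moved right
until they do not (`exists_witness_not_mem_block`). -/

/-! ### Blocks of positions and their reversal -/

/-- The first position of the block of `p`, where positions `i` and `i + 1` lie in the same block
if `i ∈ S`. -/
def blockStart (S : Finset ℕ) : ℕ → ℕ
  | 0 => 0
  | p + 1 => if p ∈ S then blockStart S p else p + 1

theorem exists_block_end (S : Finset ℕ) (p : ℕ) : ∃ h, p ≤ h ∧ h ∉ S := by
  obtain ⟨b, hb⟩ := S.exists_nat_subset_range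
  refine ⟨max p b, le_max_left _ _, fun h => ?_⟩
  have := Finset.mem_range.1 (hb h)
  omega

/-- The last position of the block of `p`. -/
def blockEnd (S : Finset ℕ) (p : ℕ) : ℕ := Nat.find (exists_block_end S p)

theorem le_blockEnd (S : Finset ℕ) (p : ℕ) : p ≤ blockEnd S p :=
  (Nat.find_spec (exists_block_end S p)).1

theorem blockEnd_notMem (S : Finset ℕ) (p : ℕ) : blockEnd S p ∉ S :=
  (Nat.find_spec (exists_block_end S p)).2

theorem blockEnd_le {S : Finset ℕ} {p i : ℕ} (hpi : p ≤ i) (hi : i ∉ S) : blockEnd S p ≤ i :=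
  Nat.find_min' (exists_block_end S p) ⟨hpi, hi⟩

theorem mem_of_lt_blockEnd {S : Finset ℕ} {p i : ℕ} (hpi : p ≤ i) (hi : i < blockEnd S p) :
    i ∈ S := by
  by_contra h
  exact absurd (blockEnd_le hpi h) (by omega)

theorem blockStart_le (S : Finset ℕ) (p : ℕ) : blockStart S p ≤ p := by
  induction p with
  | zero => simp [blockStart]
  | succ p ih => rw [blockStart]; split_ifs <;> omega

theorem mem_of_blockStart_le {S : Finset ℕ} {p i : ℕ} (hi : blockStart S p ≤ i) (hip : i < p) :
    i ∈ S := by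
  induction p with
  | zero => omega
  | succ p ih =>
    rw [blockStart] at hi
    split_ifs at hi with h
    · rcases Nat.lt_succ_iff_lt_or_eq.1 hip with h' | rfl
      · exact ih hi h'
      · exact h
    · omega

theorem lt_blockStart {S : Finset ℕ} {p i : ℕ} (hip : i < p) (hi : i ∉ S) :
    i < blockStart S p := by
  by_contra h
  exact hi (mem_of_blockStart_le (by omega) hip)

theorem block_eq {S : Finset ℕ} {p q : ℕ} (hpq : p ≤ q) (h : ∀ i, p ≤ i → i < q → i ∈ S) :
    blockStart S q = blockStart S p ∧ blockEnd S q = blockEnd S p := by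
  induction q, hpq using Nat.le_induction with
  | base => simp
  | succ q hpq ih =>
    obtain ⟨h1, h2⟩ := ih fun i hi hiq => h i hi (by omega)
    have hq : q ∈ S := h q hpq (by omega)
    refine ⟨by rw [blockStart, if_pos hq, h1], le_antisymm ?_ ?_⟩
    · have hend := blockEnd_notMem S q
      have hne : blockEnd S q ≠ q := fun e => by rw [e] at hend; exact hend hq
      have := le_blockEnd S q
      rw [← h2]
      exact blockEnd_le (by omega) hend
    · rw [← h2]
      have := le_blockEnd S (q + 1)
      exact blockEnd_le (by omega) (blockEnd_notMem S _)

/-- Either the positions from `p` to `q` lie in one block or the block of `p` precedes that of `q`. -/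
theorem block_eq_or_lt (S : Finset ℕ) (p q : ℕ) :
    (∀ i, p ≤ i → i < q → i ∈ S) ∨ blockEnd S p < blockStart S q := by
  by_cases h : ∀ i, p ≤ i → i < q → i ∈ S
  · exact .inl h
  · push Not at h
    obtain ⟨i, hpi, hiq, hi⟩ := h
    have := blockEnd_le hpi hi
    have := lt_blockStart hiq hi
    exact .inr (by omega)

/-- The map that reverses each block. -/
def blockReverse (S : Finset ℕ) (p : ℕ) : ℕ := blockStart S p + blockEnd S p - p

theorem blockStart_le_blockReverse (S : Finset ℕ) (p : ℕ) :
    blockStart S p ≤ blockReverse S p := by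
  have := le_blockEnd S p
  unfold blockReverse; omega

theorem blockReverse_le_blockEnd (S : Finset ℕ) (p : ℕ) : blockReverse S p ≤ blockEnd S p := by
  have := blockStart_le S p
  unfold blockReverse; omega

theorem block_blockReverse (S : Finset ℕ) (p : ℕ) :
    blockStart S (blockReverse S p) = blockStart S p ∧
      blockEnd S (blockReverse S p) = blockEnd S p := by
  have h1 := blockStart_le_blockReverse S p
  have h2 := blockReverse_le_blockEnd S p
  rcases le_total p (blockReverse S p) with h | h
  · exact block_eq h fun i hi hiq => mem_of_lt_blockEnd hi (by omega)
  · have := block_eq (S := S) h fun i hi hiq => mem_of_blockStart_le (by omega) hiq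
    exact ⟨this.1.symm, this.2.symm⟩

theorem blockReverse_involutive (S : Finset ℕ) : Function.Involutive (blockReverse S) := by
  intro p
  obtain ⟨h1, h2⟩ := block_blockReverse S p
  have := le_blockEnd S p
  have := blockStart_le S p
  rw [blockReverse, h1, h2, blockReverse]
  omega

/-- Distinct blocks keep their order, so only comparisons inside one block are reversed. -/
theorem blockReverse_lt {S : Finset ℕ} {p q : ℕ}
    (h : ¬ ∀ i, p ≤ i → i < q → i ∈ S) : blockReverse S p < blockReverse S q := by
  have h1 := (block_eq_or_lt S p q).resolve_left h
  have h2 := blockReverse_le_blockEnd S p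
  have h3 := blockStart_le_blockReverse S q
  omega

theorem blockReverse_succ {S : Finset ℕ} {i : ℕ} (hi : i ∈ S) :
    blockReverse S i = blockReverse S (i + 1) + 1 := by
  obtain ⟨h1, h2⟩ := block_eq (S := S) (Nat.le_succ i) fun k hk hki => by
    obtain rfl : k = i := by omega
    exact hi
  have h3 := le_blockEnd S (i + 1)
  simp only [Nat.succ_eq_add_one] at h1 h2
  rw [blockReverse, blockReverse, h1, h2]
  omega

/-- Together with `blockReverse_succ`: reversal carries the marked pair i, i + 1 to another marked
pair of the same block. -/
theorem blockReverse_succ_mem {S : Finset ℕ} {i : ℕ} (hi : i ∈ S) : blockReverse S (i + 1) ∈ S := by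
  obtain ⟨h1, h2⟩ := block_blockReverse S (i + 1)
  refine mem_of_lt_blockEnd le_rfl ?_
  have h3 := blockReverse_succ hi
  have h4 := blockReverse_le_blockEnd S i
  have h5 := (block_eq (S := S) (Nat.le_succ i) fun k hk hki => by
    obtain rfl : k = i := by omega
    exact hi).2
  simp only [Nat.succ_eq_add_one] at h5
  omega

theorem blockReverse_lt_of_subset {S : Finset ℕ} {n p : ℕ} (hS : S ⊆ Finset.range (n - 1))
    (hp : p < n) : blockReverse S p < n := by
  have h1 := blockReverse_le_blockEnd S p
  have h2 : blockEnd S p ≤ n - 1 := blockEnd_le (by omega) fun h => by simpa using hS h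
  omega

/-- The permutation of the positions that reverses each block. -/
def blockReversePerm {n : ℕ} (S : Finset ℕ) (hS : S ⊆ Finset.range (n - 1)) :
    Equiv.Perm (Fin n) :=
  Function.Involutive.toPerm
    (fun p => ⟨blockReverse S p, blockReverse_lt_of_subset hS p.2⟩)
    fun p => Fin.ext (blockReverse_involutive S p)

/-! ### Bad ascents and descents under block reversal -/

/-- The adjacent letters at positions `i` and `i + 1`, smaller one first, together with two later
letters of `π` satisfy the relation `R`. -/
def HasBadAscent {n : ℕ} (R : Fin n → Fin n → Fin n → Fin n → Prop) (i : ℕ)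
    (π : Equiv.Perm (Fin n)) : Prop :=
  ∃ p q j k : Fin n, p.val = i ∧ q.val = i + 1 ∧ q < j ∧ j < k ∧ R (π p) (π q) (π j) (π k)

/-- The adjacent letters at positions `i` and `i + 1`, larger one first, together with two later
letters of `π` satisfy the relation `R`. -/
def HasBadDescent {n : ℕ} (R : Fin n → Fin n → Fin n → Fin n → Prop) (i : ℕ)
    (π : Equiv.Perm (Fin n)) : Prop :=
  ∃ p q j k : Fin n, p.val = i ∧ q.val = i + 1 ∧ q < j ∧ j < k ∧ R (π q) (π p) (π j) (π k)

/-- A relation between the letters `x < y` of an adjacent pair and later letters `c < d` such that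
`c` lies between `x` and `y`, and a witness `d` that ends a bad ascent can be moved further to the
right. -/
structure IsStraddling {α : Type*} [LinearOrder α] (R : α → α → α → α → Prop) : Prop where
  left_lt : ∀ {x y c d}, R x y c d → x < c
  lt_right : ∀ {x y c d}, R x y c d → c < y
  lt_later : ∀ {x y c d}, R x y c d → c < d
  move : ∀ {x y c d x' c' d'}, R x y c d → c ≤ x' → R x' d c' d' → R x y c d' ∨ R x y c' d'

section Reversal

variable {n : ℕ} {R : Fin n → Fin n → Fin n → Fin n → Prop} {S : Finset ℕ}
  {π : Equiv.Perm (Fin n)}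

theorem lt_of_step_lt {f : Fin n → Fin n} {p q : Fin n} (hpq : p < q)
    (h : ∀ i, p.val ≤ i → i < q.val → ∀ a b : Fin n, a.val = i → b.val = i + 1 → f a < f b) :
    f p < f q := by
  obtain ⟨q, hq⟩ := q
  obtain ⟨p, hp⟩ := p
  simp only [Fin.mk_lt_mk] at hpq h
  induction q, hpq using Nat.le_induction with
  | base => exact h p le_rfl (by omega) _ _ rfl rfl
  | succ q hpq ih =>
    exact (ih (by omega) fun i hi hiq => h i hi (by omega)).trans
      (h q (by omega) (by omega) _ _ rfl rfl)

theorem HasBadAscent.lt (hR : IsStraddling R) {i : ℕ} (h : HasBadAscent R i π) {a b : Fin n}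
    (ha : a.val = i) (hb : b.val = i + 1) : π a < π b := by
  obtain ⟨p, q, j, k, hp, hq, -, -, h⟩ := h
  obtain rfl : a = p := Fin.ext (ha.trans hp.symm)
  obtain rfl : b = q := Fin.ext (hb.trans hq.symm)
  exact (hR.left_lt h).trans (hR.lt_right h)

theorem HasBadDescent.lt (hR : IsStraddling R) {i : ℕ} (h : HasBadDescent R i π) {a b : Fin n}
    (ha : a.val = i) (hb : b.val = i + 1) : π b < π a := by
  obtain ⟨p, q, j, k, hp, hq, -, -, h⟩ := h
  obtain rfl : a = p := Fin.ext (ha.trans hp.symm)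
  obtain rfl : b = q := Fin.ext (hb.trans hq.symm)
  exact (hR.left_lt h).trans (hR.lt_right h)

theorem lt_of_badAscents (hR : IsStraddling R) (hS : ∀ i ∈ S, HasBadAscent R i π) {p q : Fin n}
    (hpq : p < q) (h : ∀ i, p.val ≤ i → i < q.val → i ∈ S) : π p < π q :=
  lt_of_step_lt hpq fun i hi hiq _ _ ha hb => (hS i (h i hi hiq)).lt hR ha hb

theorem lt_of_badDescents (hR : IsStraddling R) (hS : ∀ i ∈ S, HasBadDescent R i π) {p q : Fin n}
    (hpq : p < q) (h : ∀ i, p.val ≤ i → i < q.val → i ∈ S) : π q < π p := by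
  have := lt_of_step_lt (f := fun a => Fin.rev (π a)) hpq fun i hi hiq _ _ ha hb =>
    Fin.rev_lt_rev.2 ((hS i (h i hi hiq)).lt hR ha hb)
  exact Fin.rev_lt_rev.1 this

/-- A bad ascent has witnesses in different blocks, if all marked ascents are bad. -/
theorem exists_witness_not_mem_block (hR : IsStraddling R) (hS : ∀ i ∈ S, HasBadAscent R i π)
    {x y : Fin n} (q : Fin n) :
    ∀ (m : ℕ) (j k : Fin n), n - k.val = m → q < j → j < k → R x y (π j) (π k) →
      ∃ j k : Fin n, q < j ∧ j < k ∧ R x y (π j) (π k) ∧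
        ¬ ∀ i, j.val ≤ i → i < k.val → i ∈ S := by
  intro m
  induction m using Nat.strong_induction_on with
  | _ m ih =>
  intro j k hm hqj hjk h
  by_cases hb : ∀ i, j.val ≤ i → i < k.val → i ∈ S
  · have hlt_jk : j.val < k.val := hjk
    have hk := k.2
    -- As j and k share a block, k ends a bad ascent; its witnesses lie further right and can
    -- replace k, or both j and k, by `move`.
    obtain ⟨p', q', j', k', hp', hq', hqj', hjk', h'⟩ :=
      hS (k.val - 1) (hb _ (by omega) (by omega))
    obtain rfl : q' = k := Fin.ext (by omega)
    have hjp : π j ≤ π p' := by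
      rcases (show j ≤ p' from Fin.le_def.2 (by omega)).eq_or_lt with rfl | hlt
      · rfl
      · exact (lt_of_badAscents hR hS hlt fun i hi hip => hb i hi (by omega)).le
    have hkk := hqj'.trans hjk'
    have hk' := k'.2
    have hlt : n - k'.val < m := by
      have : q'.val < k'.val := hkk
      omega
    rcases hR.move h hjp h' with h'' | h''
    · exact ih _ hlt j k' rfl hqj (hjk.trans hkk) h''
    · exact ih _ hlt j' k' rfl (hqj.trans (hjk.trans hqj')) hjk' h''
  · exact ⟨j, k, hqj, hjk, h, hb⟩

theorem badDescent_of_badAscents (hR : IsStraddling R) (hn : S ⊆ Finset.range (n - 1))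
    (hS : ∀ i ∈ S, HasBadAscent R i π) :
    ∀ i ∈ S, HasBadDescent R i (π * blockReversePerm S hn) := by
  intro i hi
  have hmem := blockReverse_succ_mem hi
  have hsucc := blockReverse_succ hi
  have hinv := blockReverse_involutive S
  have hin : i + 1 < n := by have := Finset.mem_range.1 (hn hi); omega
  obtain ⟨p, q, j, k, hp, hq, hqj, hjk, h⟩ := hS _ hmem
  obtain ⟨j, k, hqj, hjk, h, hb⟩ := exists_witness_not_mem_block hR hS q _ j k rfl hqj hjk h
  -- In a common block, which is increasing, c would exceed y.
  have hqj' : ¬ ∀ i, q.val ≤ i → i < j.val → i ∈ S := fun hall =>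
    (lt_of_badAscents hR hS hqj hall).not_gt (hR.lt_right h)
  have hpj' : ¬ ∀ i, p.val ≤ i → i < j.val → i ∈ S := fun hall =>
    hqj' fun i hi hij => hall i (by omega) hij
  have hpq : blockReversePerm S hn ⟨i + 1, hin⟩ = p := Fin.ext hp.symm
  have hqp : blockReversePerm S hn ⟨i, by omega⟩ = q := Fin.ext (hsucc.trans hq.symm)
  have hself : ∀ a, blockReversePerm S hn (blockReversePerm S hn a) = a := fun a =>
    Fin.ext (hinv a)
  refine ⟨⟨i, by omega⟩, ⟨i + 1, hin⟩, blockReversePerm S hn j, blockReversePerm S hn k, rfl, rfl,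
    ?_, blockReverse_lt hb, ?_⟩
  -- After reversal the second position of the pair is the image of p.
  · have := blockReverse_lt hpj'
    rw [hp, hinv] at this
    exact this
  · simpa only [Equiv.Perm.mul_apply, hself, hpq, hqp] using h

theorem badAscent_of_badDescents (hR : IsStraddling R) (hn : S ⊆ Finset.range (n - 1))
    (hS : ∀ i ∈ S, HasBadDescent R i π) :
    ∀ i ∈ S, HasBadAscent R i (π * blockReversePerm S hn) := by
  intro i hi
  have hmem := blockReverse_succ_mem hi
  have hsucc := blockReverse_succ hi
  have hinv := blockReverse_involutive S
  have hin : i + 1 < n := by have := Finset.mem_range.1 (hn hi); omega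
  obtain ⟨p, q, j, k, hp, hq, hqj, hjk, h⟩ := hS _ hmem
  -- Decreasing blocks already separate c < d, so no witness has to be moved.
  have hb : ¬ ∀ i, j.val ≤ i → i < k.val → i ∈ S := fun hall =>
    (lt_of_badDescents hR hS hjk hall).not_gt (hR.lt_later h)
  have hqj' : ¬ ∀ i, q.val ≤ i → i < j.val → i ∈ S := fun hall =>
    (lt_of_badDescents hR hS hqj hall).not_gt (hR.left_lt h)
  have hpj' : ¬ ∀ i, p.val ≤ i → i < j.val → i ∈ S := fun hall =>
    hqj' fun i hi hij => hall i (by omega) hij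
  have hpq : blockReversePerm S hn ⟨i + 1, hin⟩ = p := Fin.ext hp.symm
  have hqp : blockReversePerm S hn ⟨i, by omega⟩ = q := Fin.ext (hsucc.trans hq.symm)
  have hself : ∀ a, blockReversePerm S hn (blockReversePerm S hn a) = a := fun a =>
    Fin.ext (hinv a)
  refine ⟨⟨i, by omega⟩, ⟨i + 1, hin⟩, blockReversePerm S hn j, blockReversePerm S hn k, rfl, rfl,
    ?_, blockReverse_lt hb, ?_⟩
  · have := blockReverse_lt hpj'
    rw [hp, hinv] at this
    exact this
  · simpa only [Equiv.Perm.mul_apply, hself, hpq, hqp] using h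

/-! ### Equal counts by inclusion-exclusion -/

open Classical in
/-- As many permutations lack bad ascents as lack bad descents. -/
theorem ncard_forall_not_badAscent (hR : IsStraddling R) :
    {π : Equiv.Perm (Fin n) | ∀ i, ¬ HasBadAscent R i π}.ncard =
      {π : Equiv.Perm (Fin n) | ∀ i, ¬ HasBadDescent R i π}.ncard := by
  have key : ∀ B : ℕ → Equiv.Perm (Fin n) → Prop, (∀ i π, B i π → i + 1 < n) →
      ({π | ∀ i, ¬ B i π}.ncard : ℤ) = ∑ T ∈ (Finset.range (n - 1)).powerset,
        (-1) ^ T.card * ((Finset.univ.filter fun π => ∀ i ∈ T, B i π).card : ℤ) := by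
    intro B hB
    have h := Finset.inclusion_exclusion_card_inf_compl (Finset.range (n - 1))
      fun i => Finset.univ.filter (B i)
    have hinf : ∀ T : Finset ℕ, (T.inf fun i => Finset.univ.filter (B i)) =
        Finset.univ.filter fun π => ∀ i ∈ T, B i π := fun T => by
      ext π; simp [Finset.mem_inf]
    have hset : {π | ∀ i, ¬ B i π} =
        (((Finset.range (n - 1)).inf fun i => (Finset.univ.filter (B i))ᶜ :
          Finset (Equiv.Perm (Fin n))) : Set (Equiv.Perm (Fin n))) := by
      ext π
      simp only [Set.mem_ofPred_eq, Finset.mem_coe, Finset.mem_inf, Finset.mem_compl,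
        Finset.mem_filter, Finset.mem_univ, true_and, Finset.mem_range]
      refine ⟨fun h i _ => h i, fun h i hi => h i ?_ hi⟩
      have := hB i π hi
      omega
    rw [hset, Set.ncard_coe_finset, h]
    simp only [hinf]
  have hasc : ∀ i (π : Equiv.Perm (Fin n)), HasBadAscent R i π → i + 1 < n := by
    rintro i π ⟨p, q, j, k, hp, hq, -⟩
    omega
  have hdesc : ∀ i (π : Equiv.Perm (Fin n)), HasBadDescent R i π → i + 1 < n := by
    rintro i π ⟨p, q, j, k, hp, hq, -⟩
    omega
  have hcast := (key _ hasc).trans (Eq.trans (Finset.sum_congr rfl fun T hT => ?_)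
    (key _ hdesc).symm)
  · exact_mod_cast hcast
  · have hT := Finset.mem_powerset.1 hT
    have hself : blockReversePerm T hT * blockReversePerm T hT = 1 :=
      Equiv.ext fun a => Fin.ext (blockReverse_involutive T a)
    congr 2
    refine Finset.card_bij' (fun π _ => π * blockReversePerm T hT)
      (fun π _ => π * blockReversePerm T hT) ?_ ?_ ?_ ?_
    · intro π hπ
      simp only [Finset.mem_filter, Finset.mem_univ, true_and] at hπ ⊢
      exact badDescent_of_badAscents hR hT hπ
    · intro π hπ
      simp only [Finset.mem_filter, Finset.mem_univ, true_and] at hπ ⊢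
      exact badAscent_of_badDescents hR hT hπ
    · intro π _
      rw [mul_assoc, hself, mul_one]
    · intro π _
      rw [mul_assoc, hself, mul_one]

end Reversal

/-! ### The two relations, and discrete steps -/

theorem isStraddling_lt_outside (n : ℕ) :
    IsStraddling fun x y c d : Fin n => x < c ∧ c < y ∧ y < d where
  left_lt h := h.1
  lt_right h := h.2.1
  lt_later h := h.2.1.trans h.2.2
  move h _ h' := .inl ⟨h.1, h.2.1, h.2.2.trans h'.2.2⟩

theorem isStraddling_lt_inside (n : ℕ) :
    IsStraddling fun x y c d : Fin n => x < c ∧ c < d ∧ d < y where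
  left_lt h := h.1
  lt_right h := h.2.1.trans h.2.2
  lt_later h := h.2.1
  move h hc h' := .inr ⟨(h.1.trans_le hc).trans h'.1, h'.2.1, h'.2.2.trans h.2.2⟩

/-- A discrete intermediate value argument, used to shrink the first two positions of a copy to an
adjacent pair. -/
theorem exists_step {n : ℕ} (P : Fin n → Prop) {a b : Fin n} (hab : a < b) (ha : P a)
    (hb : ¬ P b) : ∃ p q : Fin n, a ≤ p ∧ q.val = p.val + 1 ∧ q ≤ b ∧ P p ∧ ¬ P q := by
  obtain ⟨a, ha'⟩ := a
  obtain ⟨b, hb'⟩ := b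
  simp only [Fin.mk_lt_mk] at hab
  induction b, hab using Nat.le_induction with
  | base => exact ⟨_, _, le_rfl, rfl, le_rfl, ha, hb⟩
  | succ b hab ih =>
    by_cases h : P ⟨b, by omega⟩
    · exact ⟨⟨b, by omega⟩, _, Fin.le_def.2 (by simp only; omega), rfl, le_rfl, h, hb⟩
    · obtain ⟨p, q, h1, h2, h3, h4⟩ := ih (by omega) h
      exact ⟨p, q, h1, h2, h3.trans (Fin.le_def.2 (by simp)), h4⟩

/-! ### Avoidance in terms of adjacent pairs -/

namespace BarredPattern

/-- Increasing positions `a < b < c < d` whose letters are in the relative order of the word of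
unbarred letters of a pattern in which the second letter is barred. -/
def IsUnbarredCopy {n : ℕ} (σ : BarredPattern 5) (π : Equiv.Perm (Fin n)) (a b c d : Fin n) :
    Prop :=
  -- Entry 1 of the vector is a filler, excluded by `i ≠ 1` and `j ≠ 1`.
  a < b ∧ b < c ∧ c < d ∧ ∀ i j : Fin 5, i ≠ 1 → j ≠ 1 → σ.perm i < σ.perm j →
    π (![a, a, b, c, d] i) < π (![a, a, b, c, d] j)

theorem isCopy_of_lt {ι α : Type*} [LinearOrder ι] [LinearOrder α] {n : ℕ} {w : ι → α}
    {π : Equiv.Perm (Fin n)} {f : ι → Fin n} (hf : StrictMono f) (hw : Function.Injective w)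
    (h : ∀ i j, w i < w j → π (f i) < π (f j)) : IsCopy w π f := by
  refine ⟨hf, fun i j => ⟨fun hij => ?_, h i j⟩⟩
  rcases lt_trichotomy (w i) (w j) with h' | h' | h'
  · exact h'
  · exact absurd hij (by rw [hw h']; exact lt_irrefl _)
  · exact absurd hij (h j i h').not_gt

theorem avoids_iff {n : ℕ} (σ : BarredPattern 5) (hσ : σ.barred = {1}) (π : Equiv.Perm (Fin n)) :
    Avoids π σ ↔ ∀ a b c d, σ.IsUnbarredCopy π a b c d →
      ∃ e, a < e ∧ e < b ∧ ∀ i j : Fin 5, σ.perm i < σ.perm j →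
        π (![a, e, b, c, d] i) < π (![a, e, b, c, d] j) := by
  have hmem : ∀ i : Fin 5, i ∉ σ.barred ↔ i ≠ 1 := fun i => by rw [hσ, Finset.mem_singleton]
  constructor
  · rintro h a b c d ⟨hab, hbc, hcd, hw⟩
    have hmono : StrictMono fun i : {i // i ∉ σ.barred} => ![a, a, b, c, d] i := by
      have hac := hab.trans hbc
      have had := hac.trans hcd
      have hbd := hbc.trans hcd
      rintro ⟨i, hi⟩ ⟨j, hj⟩ hij
      rw [hmem] at hi hj
      rw [Subtype.mk_lt_mk] at hij
      fin_cases i <;> fin_cases j <;> first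
        | assumption
        | exact absurd rfl hi
        | exact absurd rfl hj
        | exact absurd hij (by decide)
    obtain ⟨g, hg, hgf⟩ := h _ (isCopy_of_lt hmono
      (fun i j hij => Subtype.ext (σ.perm.injective hij))
      fun i j => hw i j ((hmem i).1 i.2) ((hmem j).1 j.2))
    have h0 : g 0 = a := hgf ⟨0, (hmem 0).2 (by decide)⟩
    have h2 : g 2 = b := hgf ⟨2, (hmem 2).2 (by decide)⟩
    have h3 : g 3 = c := hgf ⟨3, (hmem 3).2 (by decide)⟩
    have h4 : g 4 = d := hgf ⟨4, (hmem 4).2 (by decide)⟩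
    have hgv : ![a, g 1, b, c, d] = g := by
      ext i; fin_cases i <;> simp [h0, h2, h3, h4]
    refine ⟨g 1, h0 ▸ hg.1 (by decide), h2 ▸ hg.1 (by decide), fun i j hij => ?_⟩
    rw [hgv]
    exact (hg.2 i j).2 hij
  · intro h f hf
    have h02 := hf.1 (show (⟨0, (hmem 0).2 (by decide)⟩ : {i // i ∉ σ.barred}) <
      ⟨2, (hmem 2).2 (by decide)⟩ by rw [Subtype.mk_lt_mk]; decide)
    have h23 := hf.1 (show (⟨2, (hmem 2).2 (by decide)⟩ : {i // i ∉ σ.barred}) <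
      ⟨3, (hmem 3).2 (by decide)⟩ by rw [Subtype.mk_lt_mk]; decide)
    have h34 := hf.1 (show (⟨3, (hmem 3).2 (by decide)⟩ : {i // i ∉ σ.barred}) <
      ⟨4, (hmem 4).2 (by decide)⟩ by rw [Subtype.mk_lt_mk]; decide)
    have hval : ∀ e, ∀ i : {i // i ∉ σ.barred},
        ![f ⟨0, (hmem 0).2 (by decide)⟩, e, f ⟨2, (hmem 2).2 (by decide)⟩,
          f ⟨3, (hmem 3).2 (by decide)⟩, f ⟨4, (hmem 4).2 (by decide)⟩] i = f i := by
      rintro e ⟨i, hi⟩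
      have hi' := (hmem i).1 hi
      fin_cases i <;> first
        | rfl
        | exact absurd rfl hi'
    obtain ⟨e, he1, he2, he⟩ := h _ _ _ _ ⟨h02, h23, h34, fun i j hi hj hij => by
      have h1 := hval (f ⟨0, (hmem 0).2 (by decide)⟩) ⟨i, (hmem i).2 hi⟩
      have h2 := hval (f ⟨0, (hmem 0).2 (by decide)⟩) ⟨j, (hmem j).2 hj⟩
      simp only at h1 h2
      rw [h1, h2]
      exact (hf.2 _ _).2 hij⟩
    refine ⟨_, isCopy_of_lt ?_ σ.perm.injective he, hval e⟩
    rw [Fin.strictMono_iff_lt_succ]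
    intro i
    fin_cases i
    exacts [he1, he2, h23, h34]

/-- A pattern with second letter barred is avoided as soon as its extension can only fail next to
an adjacent pair, and it is not avoided if there is a copy starting with an adjacent pair. -/
theorem avoids_iff_forall_not {n : ℕ} {σ : BarredPattern 5} (hσ : σ.barred = {1})
    {π : Equiv.Perm (Fin n)} {B : ℕ → Equiv.Perm (Fin n) → Prop}
    (hB : ∀ i, B i π ↔ ∃ p q j k, p.val = i ∧ q.val = i + 1 ∧ σ.IsUnbarredCopy π p q j k)
    (h : ∀ a b c d, σ.IsUnbarredCopy π a b c d →
      (∀ e, a < e → e < b → ¬ ∀ i j : Fin 5, σ.perm i < σ.perm j →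
        π (![a, e, b, c, d] i) < π (![a, e, b, c, d] j)) → ∃ i, B i π) :
    Avoids π σ ↔ ∀ i, ¬ B i π := by
  rw [avoids_iff σ hσ]
  constructor
  · intro hav i hi
    obtain ⟨p, q, j, k, hp, hq, hc⟩ := (hB i).1 hi
    obtain ⟨e, hpe, heq, -⟩ := hav _ _ _ _ hc
    rw [Fin.lt_def] at hpe heq
    omega
  · intro hno a b c d hc
    by_contra hcon
    push Not at hcon
    obtain ⟨i, hi⟩ := h a b c d hc fun e h1 h2 h3 => by
      obtain ⟨i, j, hij, hle⟩ := hcon e h1 h2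
      exact (h3 i j hij).not_ge hle
    exact hno i hi

end BarredPattern

namespace BarredPattern

/-- Four comparisons of letters consecutive in value suffice, by transitivity. -/
theorem lt_of_chain {n : ℕ} {σ : BarredPattern 5} {π : Equiv.Perm (Fin n)} {g : Fin 5 → Fin n}
    (h : ∀ i : Fin 4, π (g (σ.perm.symm i.castSucc)) < π (g (σ.perm.symm i.succ))) :
    ∀ i j : Fin 5, σ.perm i < σ.perm j → π (g i) < π (g j) := fun i j hij => by
  have := Fin.strictMono_iff_lt_succ (f := fun x => π (g (σ.perm.symm x))).2 h hij
  simpa using this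

variable {n : ℕ} (π : Equiv.Perm (Fin n)) (a b c d : Fin n)

theorem isUnbarredCopy_p3b5124 : p3b5124.IsUnbarredCopy π a b c d ↔
    b < c ∧ c < d ∧ a < b ∧ π b < π c ∧ π c < π a ∧ π a < π d := by
  constructor
  · rintro ⟨h1, h2, h3, h⟩
    exact ⟨h2, h3, h1, h 2 3 (by decide) (by decide) (by decide),
      h 3 0 (by decide) (by decide) (by decide), h 0 4 (by decide) (by decide) (by decide)⟩
  · rintro ⟨h2, h3, h1, h4, h5, h6⟩
    refine ⟨h1, h2, h3, fun i j hi hj hij => ?_⟩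
    have h7 := h4.trans h5
    have h8 := h5.trans h6
    have h9 := h7.trans h6
    fin_cases i <;> fin_cases j <;> first
      | assumption
      | exact absurd rfl hi
      | exact absurd rfl hj
      | exact absurd hij (by decide)

theorem isUnbarredCopy_p1b5324 : p1b5324.IsUnbarredCopy π a b c d ↔
    b < c ∧ c < d ∧ a < b ∧ π a < π c ∧ π c < π b ∧ π b < π d := by
  constructor
  · rintro ⟨h1, h2, h3, h⟩
    exact ⟨h2, h3, h1, h 0 3 (by decide) (by decide) (by decide),
      h 3 2 (by decide) (by decide) (by decide), h 2 4 (by decide) (by decide) (by decide)⟩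
  · rintro ⟨h2, h3, h1, h4, h5, h6⟩
    refine ⟨h1, h2, h3, fun i j hi hj hij => ?_⟩
    have h7 := h4.trans h5
    have h8 := h5.trans h6
    have h9 := h7.trans h6
    fin_cases i <;> fin_cases j <;> first
      | assumption
      | exact absurd rfl hi
      | exact absurd rfl hj
      | exact absurd hij (by decide)

theorem isUnbarredCopy_p1b3524 : p1b3524.IsUnbarredCopy π a b c d ↔
    b < c ∧ c < d ∧ a < b ∧ π a < π c ∧ π c < π d ∧ π d < π b := by
  constructor
  · rintro ⟨h1, h2, h3, h⟩
    exact ⟨h2, h3, h1, h 0 3 (by decide) (by decide) (by decide),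
      h 3 4 (by decide) (by decide) (by decide), h 4 2 (by decide) (by decide) (by decide)⟩
  · rintro ⟨h2, h3, h1, h4, h5, h6⟩
    refine ⟨h1, h2, h3, fun i j hi hj hij => ?_⟩
    have h7 := h4.trans h5
    have h8 := h5.trans h6
    have h9 := h7.trans h6
    fin_cases i <;> fin_cases j <;> first
      | assumption
      | exact absurd rfl hi
      | exact absurd rfl hj
      | exact absurd hij (by decide)

theorem isUnbarredCopy_p5b3124 : p5b3124.IsUnbarredCopy π a b c d ↔
    b < c ∧ c < d ∧ a < b ∧ π b < π c ∧ π c < π d ∧ π d < π a := by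
  constructor
  · rintro ⟨h1, h2, h3, h⟩
    exact ⟨h2, h3, h1, h 2 3 (by decide) (by decide) (by decide),
      h 3 4 (by decide) (by decide) (by decide), h 4 0 (by decide) (by decide) (by decide)⟩
  · rintro ⟨h2, h3, h1, h4, h5, h6⟩
    refine ⟨h1, h2, h3, fun i j hi hj hij => ?_⟩
    have h7 := h4.trans h5
    have h8 := h5.trans h6
    have h9 := h7.trans h6
    fin_cases i <;> fin_cases j <;> first
      | assumption
      | exact absurd rfl hi
      | exact absurd rfl hj
      | exact absurd hij (by decide)

theorem avoids_p3b5124 : Avoids π p3b5124 ↔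
    ∀ i, ¬ HasBadDescent (fun x y c d => x < c ∧ c < y ∧ y < d) i π := by
  refine avoids_iff_forall_not rfl (fun i => ?_) fun a b c d hc hno => ?_
  · simp only [isUnbarredCopy_p3b5124]
    exact ⟨fun ⟨p, q, j, k, hp, hq, h1, h2, h3⟩ => ⟨p, q, j, k, hp, hq, h1, h2, by omega, h3⟩,
      fun ⟨p, q, j, k, hp, hq, h1, h2, _, h3⟩ => ⟨p, q, j, k, hp, hq, h1, h2, h3⟩⟩
  · obtain ⟨hbc, hcd, hab, h1, h2, h3⟩ := (isUnbarredCopy_p3b5124 π a b c d).1 hc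
    -- Between a and b the letters fall from above π c to below it. If p is not a, its letter must
    -- be below π d, or it would serve as the barred 5.
    obtain ⟨p, q, hap, hpq, hqb, hP, hQ⟩ :=
      exists_step (fun x => π c < π x) hab h2 h1.not_gt
    refine ⟨p, p, q, c, d, rfl, hpq, hqb.trans_lt hbc, hcd,
      lt_of_le_of_ne (not_lt.1 hQ) (π.injective.ne (hqb.trans_lt hbc).ne), hP, ?_⟩
    rcases hap.eq_or_lt with rfl | hap
    · exact h3
    · by_contra hcon
      have hpb : p < b := by omega
      have hdp : π d < π p :=
        lt_of_le_of_ne (not_lt.1 hcon) (π.injective.ne (hpb.trans (hbc.trans hcd)).ne')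
      refine hno p hap hpb (lt_of_chain fun i => ?_)
      fin_cases i
      exacts [h1, h2, h3, hdp]

theorem avoids_p1b5324 : Avoids π p1b5324 ↔
    ∀ i, ¬ HasBadAscent (fun x y c d => x < c ∧ c < y ∧ y < d) i π := by
  refine avoids_iff_forall_not rfl (fun i => ?_) fun a b c d hc hno => ?_
  · simp only [isUnbarredCopy_p1b5324]
    exact ⟨fun ⟨p, q, j, k, hp, hq, h1, h2, h3⟩ => ⟨p, q, j, k, hp, hq, h1, h2, by omega, h3⟩,
      fun ⟨p, q, j, k, hp, hq, h1, h2, _, h3⟩ => ⟨p, q, j, k, hp, hq, h1, h2, h3⟩⟩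
  · obtain ⟨hbc, hcd, hab, h1, h2, h3⟩ := (isUnbarredCopy_p1b5324 π a b c d).1 hc
    -- Here q, unless it is b, would serve as the barred 5 if its letter exceeded π d.
    obtain ⟨p, q, hap, hpq, hqb, hP, hQ⟩ :=
      exists_step (fun x => π x < π c) hab h1 h2.not_gt
    refine ⟨p, p, q, c, d, rfl, hpq, hqb.trans_lt hbc, hcd, hP,
      lt_of_le_of_ne (not_lt.1 hQ) (π.injective.ne (hqb.trans_lt hbc).ne'), ?_⟩
    rcases hqb.eq_or_lt with rfl | hqb
    · exact h3
    · by_contra hcon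
      have haq : a < q := by omega
      have hdq : π d < π q :=
        lt_of_le_of_ne (not_lt.1 hcon) (π.injective.ne (hqb.trans (hbc.trans hcd)).ne')
      refine hno q haq hqb (lt_of_chain fun i => ?_)
      fin_cases i
      exacts [h1, h2, h3, hdq]

theorem avoids_p1b3524 : Avoids π p1b3524 ↔
    ∀ i, ¬ HasBadAscent (fun x y c d => x < c ∧ c < d ∧ d < y) i π := by
  refine avoids_iff_forall_not rfl (fun i => ?_) fun a b c d hc hno => ?_
  · simp only [isUnbarredCopy_p1b3524]
    exact ⟨fun ⟨p, q, j, k, hp, hq, h1, h2, h3⟩ => ⟨p, q, j, k, hp, hq, h1, h2, by omega, h3⟩,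
      fun ⟨p, q, j, k, hp, hq, h1, h2, _, h3⟩ => ⟨p, q, j, k, hp, hq, h1, h2, h3⟩⟩
  · obtain ⟨hbc, hcd, hab, h1, h2, h3⟩ := (isUnbarredCopy_p1b3524 π a b c d).1 hc
    -- If q is not b, a letter at q between π c and π d would serve as the barred 3.
    obtain ⟨p, q, hap, hpq, hqb, hP, hQ⟩ :=
      exists_step (fun x => π x < π c) hab h1 (h2.trans h3).not_gt
    refine ⟨p, p, q, c, d, rfl, hpq, hqb.trans_lt hbc, hcd, hP, h2, ?_⟩
    rcases hqb.eq_or_lt with rfl | hqb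
    · exact h3
    · by_contra hcon
      have haq : a < q := by omega
      have hcq : π c < π q :=
        lt_of_le_of_ne (not_lt.1 hQ) (π.injective.ne (hqb.trans hbc).ne')
      have hqd : π q < π d :=
        lt_of_le_of_ne (not_lt.1 hcon) (π.injective.ne (hqb.trans (hbc.trans hcd)).ne)
      refine hno q haq hqb (lt_of_chain fun i => ?_)
      fin_cases i
      exacts [h1, hcq, hqd, h3]

theorem avoids_p5b3124 : Avoids π p5b3124 ↔
    ∀ i, ¬ HasBadDescent (fun x y c d => x < c ∧ c < d ∧ d < y) i π := by
  refine avoids_iff_forall_not rfl (fun i => ?_) fun a b c d hc hno => ?_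
  · simp only [isUnbarredCopy_p5b3124]
    exact ⟨fun ⟨p, q, j, k, hp, hq, h1, h2, h3⟩ => ⟨p, q, j, k, hp, hq, h1, h2, by omega, h3⟩,
      fun ⟨p, q, j, k, hp, hq, h1, h2, _, h3⟩ => ⟨p, q, j, k, hp, hq, h1, h2, h3⟩⟩
  · obtain ⟨hbc, hcd, hab, h1, h2, h3⟩ := (isUnbarredCopy_p5b3124 π a b c d).1 hc
    -- If p is not a, a letter at p between π c and π d would serve as the barred 3.
    obtain ⟨p, q, hap, hpq, hqb, hP, hQ⟩ :=
      exists_step (fun x => π c < π x) hab (h2.trans h3) h1.not_gt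
    refine ⟨p, p, q, c, d, rfl, hpq, hqb.trans_lt hbc, hcd,
      lt_of_le_of_ne (not_lt.1 hQ) (π.injective.ne (hqb.trans_lt hbc).ne), h2, ?_⟩
    rcases hap.eq_or_lt with rfl | hap
    · exact h3
    · by_contra hcon
      have hpb : p < b := by omega
      have hpd : π p < π d :=
        lt_of_le_of_ne (not_lt.1 hcon) (π.injective.ne (hpb.trans (hbc.trans hcd)).ne)
      refine hno p hap hpb (lt_of_chain fun i => ?_)
      fin_cases i
      exacts [h1, hP, hpd, h3]

end BarredPattern

theorem mainTheorem12 :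
    BarredPattern.WilfEquivalent BarredPattern.p3b5124 BarredPattern.p1b5324 ∧
      BarredPattern.WilfEquivalent BarredPattern.p1b3524 BarredPattern.p5b3124 := by
  refine ⟨fun n => ?_, fun n => ?_⟩
  · simp only [BarredPattern.avoiders, BarredPattern.avoids_p3b5124, BarredPattern.avoids_p1b5324]
    exact (ncard_forall_not_badAscent (isStraddling_lt_outside n)).symm
  · simp only [BarredPattern.avoiders, BarredPattern.avoids_p1b3524, BarredPattern.avoids_p5b3124]
    exact ncard_forall_not_badAscent (isStraddling_lt_inside n)
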